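/- Let $\mathcal D$ be a triangulated category with a bounded t-structure $(\mathcal D^{\le 0},\mathcal D^{\ge 0})$ (that is, every object of $\mathcal D$ lies in $\mathcal D^{\le n}\cap\mathcal D^{\ge m}$ for some integers $m,n$), and let $\mathcal A=\mathcal D^{\le 0}\cap\mathcal D^{\ge 0}$ be its heart, which is an abelian category. Let $(\mathcal T,\mathcal F)$ be a torsion pair in $\mathcal A$, i.e. a pair of full subcategories of $\mathcal A$, closed under isomorphisms, such that $\operatorname{Hom}(T,F)=0$ for all $T\in\mathcal T$, $F\in\mathcal F$, and such that every $E\in\mathcal A$ fits into a short exact sequence $0\to T\to E\to F\to 0$ in $\mathcal A$ with $T\in\mathcal T$ and $F\in\mathcal F$. Let $\mathcal A^{\#}=\langle\mathcal F,\mathcal T[-1]\rangle$ be the tilted heart: the smallest full subcategory of $\mathcal D$ that contains $\mathcal F$ and $\mathcal T[-1]$ and is closed under isomorphisms and under extensions (if $X\to Y\to Z\to X[1]$ is a distinguished triangle with $X$ and $Z$ in the subcategory, then $Y$ is in it). Let $\mathcal A^{\#}[1]$ be the full subcategory of the objects $X$ of $\mathcal D$ with $X[-1]\in\mathcal A^{\#}$.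 Note that $\mathcal F\subset\mathcal A^{\#}$ and $\mathcal T\subset\mathcal A^{\#}[1]$. (i) Let $E_0\in\mathcal F$, let $E\in\mathcal A^{\#}$, and let $\alpha\colon E_0\to E$ be a morphism in $\mathcal A^{\#}$. Then $\alpha$ is an epimorphism in $\mathcal A^{\#}$ if and only if $\alpha$ is a morphism in $\mathcal A$ with $E\in\mathcal F$ and the cokernel of $\alpha$ taken in $\mathcal A$ lies in $\mathcal T$. (ii) Let $E_0\in\mathcal T$, let $E\in\mathcal A^{\#}[1]$, and let $\beta\colon E\to E_0$ be a morphism in $\mathcal A^{\#}[1]$. Then $\beta$ is a monomorphism in $\mathcal A^{\#}[1]$ if and only if $\beta$ is a morphism in $\mathcal A$ with $E\in\mathcal T$ and the kernel of $\beta$ taken in $\mathcal A$ lies in $\mathcal F$. -/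

import Mathlib

open CategoryTheory CategoryTheory.Limits CategoryTheory.Pretriangulated
  CategoryTheory.Triangulated

namespace Tilting

universe v u

/-- A torsion pair `(T, F)` in an abelian category: two strictly full subcategories with
`Hom(T, F) = 0` such that every object `E` fits into a short exact sequence
`0 ⟶ X ⟶ E ⟶ Y ⟶ 0` with `X` in `T` and `Y` in `F`. -/
structure TorsionPair (A : Type u) [Category.{v} A] [Abelian A] where
  /-- the torsion class -/
  T : ObjectProperty A
  /-- the torsion-free class -/
  F : ObjectProperty A
  closed_T : T.IsClosedUnderIsomorphisms
  closed_F : F.IsClosedUnderIsomorphisms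
  hom_eq_zero : ∀ ⦃X Y : A⦄ (f : X ⟶ Y), T X → F Y → f = 0
  exists_shortExact : ∀ E : A, ∃ (X Y : A) (i : X ⟶ E) (p : E ⟶ Y) (w : i ≫ p = 0),
    T X ∧ F Y ∧ (ShortComplex.mk i p w).ShortExact

variable {D : Type u} [Category.{v} D] [Preadditive D] [HasZeroObject D] [HasShift D ℤ]
  [∀ n : ℤ, (shiftFunctor D n).Additive] [Pretriangulated D]

/-- The extension-closure of a class `P` of objects in a triangulated category: the smallest
class of objects which contains `P` and is closed under isomorphisms and under extensions. -/
inductive extensionClosure (P : ObjectProperty D) : D → Prop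
  | of (X : D) (hX : P X) : extensionClosure P X
  | of_iso (X Y : D) (e : X ≅ Y) (hX : extensionClosure P X) : extensionClosure P Y
  | ext (X Y Z : D) (f : X ⟶ Y) (g : Y ⟶ Z) (h : Z ⟶ X⟦(1 : ℤ)⟧)
      (hT : Triangle.mk f g h ∈ distTriang D)
      (hX : extensionClosure P X) (hZ : extensionClosure P Z) : extensionClosure P Y

lemma triangle_mk_distinguished_of_iso {X X' Y Z : D} (e : X' ≅ X) (f : X ⟶ Y) (g : Y ⟶ Z)
    (h : Z ⟶ X⟦(1 : ℤ)⟧) (hT : Triangle.mk f g h ∈ distTriang D) :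
    Triangle.mk (e.hom ≫ f) g (h ≫ e.inv⟦(1 : ℤ)⟧') ∈ distTriang D :=
  isomorphic_distinguished _ hT _ (Triangle.isoMk _ _ e (Iso.refl Y) (Iso.refl Z)
    (Category.comp_id (e.hom ≫ f))
    ((Category.comp_id g).trans (Category.id_comp g).symm)
    (show (h ≫ e.inv⟦(1 : ℤ)⟧') ≫ e.hom⟦(1 : ℤ)⟧' = 𝟙 Z ≫ h by
      rw [Category.assoc, ← Functor.map_comp, e.inv_hom_id, CategoryTheory.Functor.map_id, Category.comp_id,
        Category.id_comp]))

variable (t : TStructure D)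

lemma heart_isClosedUnderFiniteProducts : t.heart.IsClosedUnderFiniteProducts := by
  have : t.heart.ContainsZero :=
    ⟨_, isZero_zero D, (t.isLE_of_isZero (isZero_zero D) 0).le,
      (t.isGE_of_isZero (isZero_zero D) 0).ge⟩
  have : t.heart.IsClosedUnderBinaryProducts :=
    ⟨by
      rintro X ⟨p⟩
      have h₁ := p.prop_diag_obj ⟨WalkingPair.left⟩
      have h₂ := p.prop_diag_obj ⟨WalkingPair.right⟩
      have hT := binaryProductTriangle_distinguished
        (p.diag.obj ⟨WalkingPair.left⟩) (p.diag.obj ⟨WalkingPair.right⟩)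
      refine t.heart.prop_of_iso (IsLimit.conePointUniqueUpToIso (prodIsProd _ _)
        ((IsLimit.postcomposeHomEquiv (diagramIsoPair p.diag) _).2 p.isLimit)) ?_
      exact ⟨(t.isLE₂ _ hT 0 ⟨h₁.1⟩ ⟨h₂.1⟩).le, (t.isGE₂ _ hT 0 ⟨h₁.2⟩ ⟨h₂.2⟩).ge⟩⟩
  exact .mk'

lemma heart_hom_shift_eq_zero ⦃X Y : t.heart.FullSubcategory⦄ ⦃n : ℤ⦄
    (f : t.heart.ι.obj X ⟶ (t.heart.ι.obj Y)⟦n⟧) (hn : n < 0) : f = 0 := by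
  have hX : t.IsLE (t.heart.ι.obj X) 0 := ⟨X.property.1⟩
  have hY : t.IsGE (t.heart.ι.obj Y) 0 := ⟨Y.property.2⟩
  have : t.IsGE ((t.heart.ι.obj Y)⟦n⟧) (-n) := t.isGE_shift _ 0 n (-n)
  exact t.zero f 0 (-n)

variable [IsTriangulated D]

lemma heart_admissibleMorphism :
    AbelianSubcategory.admissibleMorphism t.heart.ι = ⊤ := by
  ext X₁ X₂ f₁
  simp only [MorphismProperty.top_apply, iff_true]
  intro X₃ f₂ f₃ hT
  have h₁ : t.IsLE (t.heart.ι.obj X₁) 0 := ⟨X₁.property.1⟩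
  have h₁' : t.IsGE (t.heart.ι.obj X₁) 0 := ⟨X₁.property.2⟩
  have h₂ : t.IsLE (t.heart.ι.obj X₂) 0 := ⟨X₂.property.1⟩
  have h₂' : t.IsGE (t.heart.ι.obj X₂) 0 := ⟨X₂.property.2⟩
  have h₄ : t.IsLE ((t.heart.ι.obj X₁)⟦(1 : ℤ)⟧) (-1) := t.isLE_shift _ 0 1 (-1)
  have h₄' : t.IsGE ((t.heart.ι.obj X₁)⟦(1 : ℤ)⟧) (-1) := t.isGE_shift _ 0 1 (-1)
  have h₅ : t.IsLE ((t.heart.ι.obj X₁)⟦(1 : ℤ)⟧) 0 := t.isLE_of_le _ (-1) 0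
  have h₆ : t.IsGE (t.heart.ι.obj X₂) (-1) := t.isGE_of_ge _ (-1) 0
  have h₃ : t.IsLE X₃ 0 :=
    t.isLE₂ _ (rot_of_distTriang _ hT) 0 h₂ h₅
  have h₃' : t.IsGE X₃ (-1) :=
    t.isGE₂ _ (rot_of_distTriang _ hT) (-1) h₆ h₄'
  let L := (t.truncLE (-1)).obj X₃
  let G := (t.truncGE 0).obj X₃
  have hL : t.IsLE (L⟦(-1 : ℤ)⟧) 0 := t.isLE_shift _ (-1) (-1) 0
  have hL' : t.IsGE (L⟦(-1 : ℤ)⟧) 0 := t.isGE_shift _ (-1) (-1) 0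
  have hG : t.IsLE G 0 := inferInstance
  have hG' : t.IsGE G 0 := inferInstance
  let e : (L⟦(-1 : ℤ)⟧)⟦(1 : ℤ)⟧ ≅ L := (shiftFunctorCompIsoId D (-1) 1 (by simp)).app L
  have hd := t.triangleLEGE_distinguished (-1) 0 (by simp) X₃
  exact ⟨⟨L⟦(-1 : ℤ)⟧, hL.le, hL'.ge⟩, ⟨G, hG.le, hG'.ge⟩, _, _, _,
    triangle_mk_distinguished_of_iso e _ _ _ hd⟩

/-- The heart of a t-structure is an abelian category. -/
noncomputable instance heartAbelian : Abelian t.heart.FullSubcategory :=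
  haveI := heart_isClosedUnderFiniteProducts t
  AbelianSubcategory.abelian t.heart.ι (heart_hom_shift_eq_zero t) (heart_admissibleMorphism t)

variable {t}

/-- The tilt `A^# = ⟨F, T[-1]⟩` of the heart `A` of `t` at a torsion pair `(T, F)`, as a class
of objects of `D`. Recall that `P.shift 1` is the class of the `X` such that `X⟦1⟧` is in `P`,
that is, the class usually denoted `P[-1]`. -/
def TorsionPair.tilt (τ : TorsionPair t.heart.FullSubcategory) : ObjectProperty D :=
  extensionClosure (τ.F.map t.heart.ι ⊔ (τ.T.map t.heart.ι).shift (1 : ℤ))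

/-- The class `A^#[1]` of the objects `X` of `D` such that `X⟦-1⟧` is in `A^#`. -/
def TorsionPair.tiltShift (τ : TorsionPair t.heart.FullSubcategory) : ObjectProperty D :=
  τ.tilt.shift (-1 : ℤ)

/-- `F` is contained in `A^#`. -/
lemma TorsionPair.tilt_of_F (τ : TorsionPair t.heart.FullSubcategory)
    {E : t.heart.FullSubcategory} (hE : τ.F E) : τ.tilt E.obj :=
  .of _ (Or.inl ⟨E, hE, ⟨Iso.refl _⟩⟩)

/-- `T` is contained in `A^#[1]`. -/
lemma TorsionPair.tiltShift_of_T (τ : TorsionPair t.heart.FullSubcategory)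
    {E : t.heart.FullSubcategory} (hE : τ.T E) : τ.tiltShift E.obj :=
  .of _ (Or.inr ⟨E, hE, ⟨((shiftFunctorCompIsoId D (-1 : ℤ) 1 (by simp)).app E.obj).symm⟩⟩)

end Tilting

/-!
Each class of a torsion pair is the orthogonal of the other within the heart. Being orthogonal to
a fixed class and lying in given degrees of the t-structure are conditions stable under extensions,
so they can be checked on the generators `F` and `T[-1]` of `A^#`: its objects `X` lie in degrees
`0` and `1`, with `Hom(T, X) = 0` and `Hom(X, F[-1]) = 0`. Since truncation preserves such
orthogonality, `τ^{≤0} X` is in `F` and `τ^{≥1} X` is in `T[-1]`.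

If `E₀ ⟶ E` is an epimorphism in `A^#` with `E₀` in `F`, then `E ⟶ τ^{≥1} E` vanishes, as it does
so after composition with `E₀ ⟶ E`; thus `E = τ^{≤0} E` is in `F`. For `E` in `F`, morphisms
`E ⟶ G` in `A^#` factor uniquely through `τ^{≤0} G`, which is in `F`. Hence being an epimorphism
in `A^#` and having a torsion cokernel both mean that `0` is the only morphism from `E` to an
object of `F` which vanishes on `E₀`. Part (ii) is dual.
-/

namespace Tilting

universe v u

section Orthogonal

variable {C : Type*} [Category* C] {C' : Type*} [Category* C']

lemma map_ι_iff {Q : ObjectProperty C} (P : ObjectProperty Q.FullSubcategory)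
    [P.IsClosedUnderIsomorphisms] [Q.IsClosedUnderIsomorphisms] {X : C} :
    P.map Q.ι X ↔ ∃ hX : Q X, P ⟨X, hX⟩ := by
  constructor
  · rintro ⟨Y, hY, ⟨e⟩⟩
    exact ⟨Q.prop_of_iso e Y.property, P.prop_of_iso (Q.isoMk e) hY⟩
  · rintro ⟨hX, hPX⟩
    exact P.prop_map_obj Q.ι hPX

variable [HasZeroMorphisms C] [HasZeroMorphisms C']

lemma rightOrthogonal_map_obj_iff (P : ObjectProperty C) (G : C ⥤ C') [G.Full] [G.Faithful]
    (X : C) : (P.map G).rightOrthogonal (G.obj X) ↔ P.rightOrthogonal X := by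
  constructor
  · intro hX Y f hY
    rw [← G.map_eq_zero_iff]
    exact hX (G.map f) (P.prop_map_obj G hY)
  · rintro hX Y f ⟨Z, hZ, ⟨e⟩⟩
    obtain ⟨g, hg⟩ := G.map_surjective (e.hom ≫ f)
    rw [← cancel_epi e.hom, ← hg, hX g hZ, G.map_zero, comp_zero]

lemma leftOrthogonal_map_obj_iff (P : ObjectProperty C) (G : C ⥤ C') [G.Full] [G.Faithful]
    (X : C) : (P.map G).leftOrthogonal (G.obj X) ↔ P.leftOrthogonal X := by
  constructor
  · intro hX Y f hY
    rw [← G.map_eq_zero_iff]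
    exact hX (G.map f) (P.prop_map_obj G hY)
  · rintro hX Y f ⟨Z, hZ, ⟨e⟩⟩
    obtain ⟨g, hg⟩ := G.map_surjective (f ≫ e.inv)
    rw [← cancel_mono e.inv, ← hg, hX g hZ, G.map_zero, zero_comp]

lemma rightOrthogonal_inverseImage (P : ObjectProperty C') [P.IsClosedUnderIsomorphisms]
    (G : C ⥤ C') [G.IsEquivalence] :
    (P.inverseImage G).rightOrthogonal = P.rightOrthogonal.inverseImage G := by
  ext X
  constructor
  · intro hX Y f hY
    obtain ⟨g, hg⟩ := G.map_surjective ((G.objObjPreimageIso Y).hom ≫ f)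
    have hg₀ : g = 0 := hX g (P.prop_of_iso (G.objObjPreimageIso Y).symm hY)
    rw [← cancel_epi (G.objObjPreimageIso Y).hom, ← hg, hg₀, G.map_zero, comp_zero]
  · intro hX Y f hY
    rw [← G.map_eq_zero_iff]
    exact hX (G.map f) hY

lemma leftOrthogonal_inverseImage (P : ObjectProperty C') [P.IsClosedUnderIsomorphisms]
    (G : C ⥤ C') [G.IsEquivalence] :
    (P.inverseImage G).leftOrthogonal = P.leftOrthogonal.inverseImage G := by
  ext X
  constructor
  · intro hX Y f hY
    obtain ⟨g, hg⟩ := G.map_surjective (f ≫ (G.objObjPreimageIso Y).inv)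
    have hg₀ : g = 0 := hX g (P.prop_of_iso (G.objObjPreimageIso Y).symm hY)
    rw [← cancel_mono (G.objObjPreimageIso Y).inv, ← hg, hg₀, G.map_zero, zero_comp]
  · intro hX Y f hY
    rw [← G.map_eq_zero_iff]
    exact hX (G.map f) hY

lemma leftOrthogonal_cokernel_iff (P : ObjectProperty C) {X Y : C} (a : X ⟶ Y)
    [HasCokernel a] :
    P.leftOrthogonal (cokernel a) ↔ ∀ ⦃Z : C⦄ (φ : Y ⟶ Z), P Z → a ≫ φ = 0 → φ = 0 := by
  constructor
  · intro h Z φ hZ hφ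
    rw [← cokernel.π_desc a φ hφ, h (cokernel.desc a φ hφ) hZ, comp_zero]
  · intro h Z φ hZ
    rw [← cancel_epi (cokernel.π a), comp_zero]
    exact h _ hZ (by rw [cokernel.condition_assoc, zero_comp])

lemma rightOrthogonal_kernel_iff (P : ObjectProperty C) {X Y : C} (b : X ⟶ Y)
    [HasKernel b] :
    P.rightOrthogonal (kernel b) ↔ ∀ ⦃Z : C⦄ (φ : Z ⟶ X), P Z → φ ≫ b = 0 → φ = 0 := by
  constructor
  · intro h Z φ hZ hφ
    rw [← kernel.lift_ι b φ hφ, h (kernel.lift b φ hφ) hZ, zero_comp]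
  · intro h Z φ hZ
    rw [← cancel_mono (kernel.ι b), zero_comp]
    exact h _ hZ (by rw [Category.assoc, kernel.condition, comp_zero])

end Orthogonal

namespace TorsionPair

variable {A : Type u} [Category.{v} A] [Abelian A] (τ : TorsionPair A)

instance : τ.T.IsClosedUnderIsomorphisms := τ.closed_T

instance : τ.F.IsClosedUnderIsomorphisms := τ.closed_F

lemma F_eq_rightOrthogonal : τ.F = τ.T.rightOrthogonal := by
  refine le_antisymm (fun Y hY X f hX ↦ τ.hom_eq_zero f hX hY) fun E hE ↦ ?_
  obtain ⟨X, Y, i, p, w, hX, hY, hS⟩ := τ.exists_shortExact E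
  have : Epi p := hS.epi_g
  have : Mono p := hS.exact.mono_g (hE i hX)
  have : IsIso p := isIso_of_mono_of_epi p
  exact τ.F.prop_of_iso (asIso p).symm hY

lemma T_eq_leftOrthogonal : τ.T = τ.F.leftOrthogonal := by
  refine le_antisymm (fun X hX Y f hY ↦ τ.hom_eq_zero f hX hY) fun E hE ↦ ?_
  obtain ⟨X, Y, i, p, w, hX, hY, hS⟩ := τ.exists_shortExact E
  have : Mono i := hS.mono_f
  have : Epi i := hS.exact.epi_f (hE p hY)
  have : IsIso i := isIso_of_mono_of_epi i
  exact τ.T.prop_of_iso (asIso i) hX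

lemma T_cokernel_iff {X Y : A} (a : X ⟶ Y) :
    τ.T (cokernel a) ↔ ∀ ⦃Z : A⦄ (φ : Y ⟶ Z), τ.F Z → a ≫ φ = 0 → φ = 0 := by
  rw [T_eq_leftOrthogonal, leftOrthogonal_cokernel_iff]

lemma F_kernel_iff {X Y : A} (b : X ⟶ Y) :
    τ.F (kernel b) ↔ ∀ ⦃Z : A⦄ (φ : Z ⟶ X), τ.T Z → φ ≫ b = 0 → φ = 0 := by
  rw [F_eq_rightOrthogonal, rightOrthogonal_kernel_iff]

end TorsionPair

variable {D : Type u} [Category.{v} D] [Preadditive D] [HasZeroObject D] [HasShift D ℤ]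
  [∀ n : ℤ, (shiftFunctor D n).Additive] [Pretriangulated D]

section ExtensionClosure

variable (P : ObjectProperty D)

instance : ObjectProperty.IsClosedUnderIsomorphisms (extensionClosure P) where
  of_iso e hX := .of_iso _ _ e hX

variable {P} in
lemma extensionClosure_le {Q : ObjectProperty D} [Q.IsClosedUnderIsomorphisms]
    [Q.IsTriangulatedClosed₂] (h : P ≤ Q) : extensionClosure P ≤ Q := by
  intro X hX
  induction hX with
  | of X hX => exact h X hX
  | of_iso X Y e _ hX => exact Q.prop_of_iso e hX
  | ext X Y Z f g h hT _ _ hX hZ => exact Q.ext_of_isTriangulatedClosed₂ _ hT hX hZ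

end ExtensionClosure

section TStructure

variable (t : TStructure D)

instance (n : ℤ) : (t.le n).IsTriangulatedClosed₂ :=
  .mk' fun T hT h₁ h₃ ↦ (t.isLE₂ T hT n ⟨h₁⟩ ⟨h₃⟩).le

instance (n : ℤ) : (t.ge n).IsTriangulatedClosed₂ :=
  .mk' fun T hT h₁ h₃ ↦ (t.isGE₂ T hT n ⟨h₁⟩ ⟨h₃⟩).ge

instance (X : t.heart.FullSubcategory) : t.IsLE X.obj 0 := ⟨X.property.1⟩

instance (X : t.heart.FullSubcategory) : t.IsGE X.obj 0 := ⟨X.property.2⟩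

lemma shift_heart (n : ℤ) : t.heart.shift n = t.le n ⊓ t.ge n := by
  rw [← t.shift_le n 0 n (add_zero n), ← t.shift_ge n 0 n (add_zero n)]
  rfl

lemma map_heart_le (P : ObjectProperty t.heart.FullSubcategory) : P.map t.heart.ι ≤ t.heart := by
  rintro X ⟨Y, -, ⟨e⟩⟩
  exact t.heart.prop_of_iso e Y.property

lemma shift_map_heart_le (P : ObjectProperty t.heart.FullSubcategory) (n : ℤ) :
    (P.map t.heart.ι).shift n ≤ t.le n ⊓ t.ge n := by
  rw [← shift_heart]
  exact fun X hX ↦ map_heart_le t P _ hX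

variable {t}

lemma rightOrthogonal_truncLE {P : ObjectProperty D} {n : ℤ} (hP : P ≤ t.le n) {X : D}
    (hX : P.rightOrthogonal X) : P.rightOrthogonal ((t.truncLE n).obj X) := by
  intro Y f hY
  have : t.IsLE Y n := ⟨hP Y hY⟩
  exact t.to_truncLE_obj_ext ((hX _ hY).trans zero_comp.symm)

lemma leftOrthogonal_truncGE {P : ObjectProperty D} {n : ℤ} (hP : P ≤ t.ge n) {X : D}
    (hX : P.leftOrthogonal X) : P.leftOrthogonal ((t.truncGE n).obj X) := by
  intro Y f hY
  have : t.IsGE Y n := ⟨hP Y hY⟩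
  exact t.from_truncGE_obj_ext ((hX _ hY).trans comp_zero.symm)

variable {P : ObjectProperty D} {X Y : P.FullSubcategory}

lemma isLE_of_epi (f : X ⟶ Y) [Epi f] {n₀ n₁ : ℤ} (h : n₀ + 1 = n₁) [t.IsLE X.obj n₀]
    (hY : P ((t.truncGE n₁).obj Y.obj)) : t.IsLE Y.obj n₀ := by
  let π : Y ⟶ ⟨_, hY⟩ := ObjectProperty.homMk ((t.truncGEπ n₁).app Y.obj)
  have hfπ : f ≫ π = 0 := by
    ext
    exact t.zero _ n₀ n₁
  have hπ : (t.truncGEπ n₁).app Y.obj = 0 := congrArg (·.hom) (zero_of_epi_comp f hfπ)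
  rw [t.isLE_iff_isZero_truncGE_obj n₀ n₁ h, IsZero.iff_id_eq_zero]
  exact t.from_truncGE_obj_ext (by rw [hπ, zero_comp, zero_comp])

lemma isGE_of_mono (f : X ⟶ Y) [Mono f] {n₀ n₁ : ℤ} (h : n₀ + 1 = n₁) [t.IsGE Y.obj n₁]
    (hX : P ((t.truncLE n₀).obj X.obj)) : t.IsGE X.obj n₁ := by
  let ι : ⟨_, hX⟩ ⟶ X := ObjectProperty.homMk ((t.truncLEι n₀).app X.obj)
  have hιf : ι ≫ f = 0 := by
    ext
    exact t.zero _ n₀ n₁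
  have hι : (t.truncLEι n₀).app X.obj = 0 := congrArg (·.hom) (zero_of_comp_mono f hιf)
  rw [t.isGE_iff_isZero_truncLE_obj n₀ n₁ h, IsZero.iff_id_eq_zero]
  exact t.to_truncLE_obj_ext (by rw [hι, comp_zero, comp_zero])

end TStructure

namespace TorsionPair

variable [IsTriangulated D] {t : TStructure D} (τ : TorsionPair t.heart.FullSubcategory)

lemma map_F_eq : τ.F.map t.heart.ι = t.heart ⊓ (τ.T.map t.heart.ι).rightOrthogonal := by
  ext X
  rw [map_ι_iff, F_eq_rightOrthogonal, ObjectProperty.prop_inf_iff, ← exists_prop]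
  exact exists_congr fun hX ↦ (rightOrthogonal_map_obj_iff τ.T t.heart.ι ⟨X, hX⟩).symm

lemma map_T_eq : τ.T.map t.heart.ι = t.heart ⊓ (τ.F.map t.heart.ι).leftOrthogonal := by
  ext X
  rw [map_ι_iff, T_eq_leftOrthogonal, ObjectProperty.prop_inf_iff, ← exists_prop]
  exact exists_congr fun hX ↦ (leftOrthogonal_map_obj_iff τ.F t.heart.ι ⟨X, hX⟩).symm

lemma shift_map_F_eq (n : ℤ) : (τ.F.map t.heart.ι).shift n =
    (t.le n ⊓ t.ge n) ⊓ ((τ.T.map t.heart.ι).shift n).rightOrthogonal := by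
  rw [map_F_eq, ← shift_heart]
  exact congrArg (t.heart.shift n ⊓ ·) (rightOrthogonal_inverseImage _ (shiftFunctor D n)).symm

lemma shift_map_T_eq (n : ℤ) : (τ.T.map t.heart.ι).shift n =
    (t.le n ⊓ t.ge n) ⊓ ((τ.F.map t.heart.ι).shift n).leftOrthogonal := by
  rw [map_T_eq, ← shift_heart]
  exact congrArg (t.heart.shift n ⊓ ·) (leftOrthogonal_inverseImage _ (shiftFunctor D n)).symm

instance : τ.tilt.IsClosedUnderIsomorphisms :=
  inferInstanceAs (ObjectProperty.IsClosedUnderIsomorphisms (extensionClosure _))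

lemma tilt_le_ge : τ.tilt ≤ t.ge 0 := by
  refine extensionClosure_le (sup_le (fun X hX ↦ (map_heart_le t _ X hX).2) fun X hX ↦ ?_)
  exact t.ge_antitone zero_le_one X (shift_map_heart_le t _ 1 X hX).2

lemma tilt_le_le : τ.tilt ≤ t.le 1 := by
  refine extensionClosure_le (sup_le (fun X hX ↦ ?_) fun X hX ↦ (shift_map_heart_le t _ 1 X hX).1)
  exact t.le_monotone zero_le_one X (map_heart_le t _ X hX).1

lemma tilt_le_rightOrthogonal : τ.tilt ≤ (τ.T.map t.heart.ι).rightOrthogonal := by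
  refine extensionClosure_le (sup_le (τ.map_F_eq.trans_le inf_le_right) fun X hX Y f hY ↦ ?_)
  exact t.zero_of_isLE_of_isGE f 0 1 zero_lt_one ⟨(map_heart_le t _ Y hY).1⟩
    ⟨(shift_map_heart_le t _ 1 X hX).2⟩

lemma tilt_le_leftOrthogonal : τ.tilt ≤ ((τ.F.map t.heart.ι).shift (1 : ℤ)).leftOrthogonal := by
  refine extensionClosure_le (sup_le (fun X hX Y f hY ↦ ?_)
    ((τ.shift_map_T_eq 1).trans_le inf_le_right))
  exact t.zero_of_isLE_of_isGE f 0 1 zero_lt_one ⟨(map_heart_le t _ X hX).1⟩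
    ⟨(shift_map_heart_le t _ 1 Y hY).2⟩

lemma shift_map_F_le_shift_tilt (n : ℤ) : (τ.F.map t.heart.ι).shift n ≤ τ.tilt.shift n :=
  fun _ hX ↦ .of _ (Or.inl hX)

lemma shift_map_T_le_shift_tilt {n m : ℤ} (h : n + 1 = m) :
    (τ.T.map t.heart.ι).shift m ≤ τ.tilt.shift n := by
  rw [← ObjectProperty.shift_shift _ n 1 m h]
  exact fun _ hX ↦ .of _ (Or.inr hX)

lemma shift_map_F_truncLE {n : ℤ} {X : D} (hX : τ.tilt.shift n X) :
    (τ.F.map t.heart.ι).shift n ((t.truncLE n).obj X) := by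
  have : t.IsGE X n := ⟨t.shift_ge n 0 n (add_zero n) ▸ τ.tilt_le_ge _ hX⟩
  have hT : ((τ.T.map t.heart.ι).shift n).rightOrthogonal X :=
    (rightOrthogonal_inverseImage _ (shiftFunctor D n)).ge X (τ.tilt_le_rightOrthogonal _ hX)
  rw [shift_map_F_eq]
  exact ⟨⟨t.le_of_isLE _ n, t.ge_of_isGE _ n⟩,
    rightOrthogonal_truncLE (fun Y hY ↦ (shift_map_heart_le t _ n Y hY).1) hT⟩

lemma shift_map_T_truncGE {n m : ℤ} (h : n + 1 = m) {X : D} (hX : τ.tilt.shift n X) :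
    (τ.T.map t.heart.ι).shift m ((t.truncGE m).obj X) := by
  have : t.IsLE X m := ⟨t.shift_le n 1 m h ▸ τ.tilt_le_le _ hX⟩
  have hF : ((τ.F.map t.heart.ι).shift m).leftOrthogonal X := by
    rw [← ObjectProperty.shift_shift _ n 1 m h]
    exact (leftOrthogonal_inverseImage _ (shiftFunctor D n)).ge X (τ.tilt_le_leftOrthogonal _ hX)
  rw [shift_map_T_eq]
  exact ⟨⟨t.le_of_isLE _ m, t.ge_of_isGE _ m⟩,
    leftOrthogonal_truncGE (fun Y hY ↦ (shift_map_heart_le t _ m Y hY).2) hF⟩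

lemma map_F_truncLE_of_tilt {X : D} (hX : τ.tilt X) :
    τ.F.map t.heart.ι ((t.truncLE 0).obj X) := by
  rw [← τ.tilt.shift_zero ℤ] at hX
  rw [← (τ.F.map t.heart.ι).shift_zero ℤ]
  exact τ.shift_map_F_truncLE hX

lemma tilt_truncGE {X : D} (hX : τ.tilt X) : τ.tilt ((t.truncGE 1).obj X) := by
  rw [← τ.tilt.shift_zero ℤ] at hX ⊢
  exact τ.shift_map_T_le_shift_tilt (zero_add 1) _ (τ.shift_map_T_truncGE (zero_add 1) hX)

lemma map_T_truncGE_of_tiltShift {X : D} (hX : τ.tiltShift X) :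
    τ.T.map t.heart.ι ((t.truncGE 0).obj X) := by
  rw [← (τ.T.map t.heart.ι).shift_zero ℤ]
  exact τ.shift_map_T_truncGE (neg_add_cancel 1) hX

lemma tiltShift_truncLE {X : D} (hX : τ.tiltShift X) : τ.tiltShift ((t.truncLE (-1)).obj X) :=
  τ.shift_map_F_le_shift_tilt (-1) _ (τ.shift_map_F_truncLE hX)

theorem epi_tilt_iff (E₀ : t.heart.FullSubcategory) (hE₀ : τ.F E₀) (E : τ.tilt.FullSubcategory)
    (α : (⟨E₀.obj, τ.tilt_of_F hE₀⟩ : τ.tilt.FullSubcategory) ⟶ E) :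
    Epi α ↔ ∃ hE : t.heart E.obj, τ.F ⟨E.obj, hE⟩ ∧
      τ.T (cokernel (ObjectProperty.homMk α.hom : E₀ ⟶ ⟨E.obj, hE⟩)) := by
  simp only [T_cokernel_iff]
  constructor
  · intro hα
    have hELE : t.IsLE E.obj 0 := isLE_of_epi α (zero_add 1) (τ.tilt_truncGE E.property)
    obtain ⟨hE, hEF⟩ := (map_ι_iff τ.F).1 ((τ.F.map t.heart.ι).prop_of_iso
      (asIso ((t.truncLEι 0).app E.obj)) (τ.map_F_truncLE_of_tilt E.property))
    refine ⟨hE, hEF, fun W φ hW hφ ↦ ?_⟩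
    let φ' : E ⟶ ⟨W.obj, τ.tilt_of_F hW⟩ := ObjectProperty.homMk φ.hom
    have hφ' : α ≫ φ' = 0 := by
      ext
      exact congrArg (·.hom) hφ
    ext
    exact congrArg (·.hom) (zero_of_epi_comp α hφ')
  · rintro ⟨hE, -, hα⟩
    refine Preadditive.epi_of_cancel_zero _ fun {G} γ hγ ↦ ?_
    have hELE : t.IsLE E.obj 0 := ⟨hE.1⟩
    obtain ⟨hW, hWF⟩ := (map_ι_iff τ.F).1 (τ.map_F_truncLE_of_tilt G.property)
    let φ : (⟨E.obj, hE⟩ : t.heart.FullSubcategory) ⟶ ⟨_, hW⟩ :=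
      ObjectProperty.homMk (t.liftTruncLE γ.hom 0)
    have hφ : φ = 0 := by
      refine hα φ hWF ?_
      ext
      refine t.to_truncLE_obj_ext ?_
      change (α.hom ≫ t.liftTruncLE γ.hom 0) ≫ _ = 0 ≫ _
      rw [Category.assoc, t.liftTruncLE_ι, zero_comp]
      exact congrArg (·.hom) hγ
    ext
    rw [← t.liftTruncLE_ι γ.hom 0]
    exact (congrArg (·.hom ≫ (t.truncLEι 0).app G.obj) hφ).trans zero_comp

theorem mono_tiltShift_iff (E₀ : t.heart.FullSubcategory) (hE₀ : τ.T E₀)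
    (E : τ.tiltShift.FullSubcategory)
    (β : E ⟶ (⟨E₀.obj, τ.tiltShift_of_T hE₀⟩ : τ.tiltShift.FullSubcategory)) :
    Mono β ↔ ∃ hE : t.heart E.obj, τ.T ⟨E.obj, hE⟩ ∧
      τ.F (kernel
        (ObjectProperty.homMk β.hom : (⟨E.obj, hE⟩ : t.heart.FullSubcategory) ⟶ E₀)) := by
  simp only [F_kernel_iff]
  constructor
  · intro hβ
    have hEGE : t.IsGE E.obj 0 :=
      isGE_of_mono β (neg_add_cancel 1) (τ.tiltShift_truncLE E.property)
    obtain ⟨hE, hET⟩ := (map_ι_iff τ.T).1 ((τ.T.map t.heart.ι).prop_of_iso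
      (asIso ((t.truncGEπ 0).app E.obj)).symm (τ.map_T_truncGE_of_tiltShift E.property))
    refine ⟨hE, hET, fun W φ hW hφ ↦ ?_⟩
    let φ' : ⟨W.obj, τ.tiltShift_of_T hW⟩ ⟶ E := ObjectProperty.homMk φ.hom
    have hφ' : φ' ≫ β = 0 := by
      ext
      exact congrArg (·.hom) hφ
    ext
    exact congrArg (·.hom) (zero_of_comp_mono β hφ')
  · rintro ⟨hE, -, hβ⟩
    refine Preadditive.mono_of_cancel_zero _ fun {G} γ hγ ↦ ?_
    have hEGE : t.IsGE E.obj 0 := ⟨hE.2⟩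
    obtain ⟨hW, hWT⟩ := (map_ι_iff τ.T).1 (τ.map_T_truncGE_of_tiltShift G.property)
    let φ : ⟨_, hW⟩ ⟶ (⟨E.obj, hE⟩ : t.heart.FullSubcategory) :=
      ObjectProperty.homMk (t.descTruncGE γ.hom 0)
    have hφ : φ = 0 := by
      refine hβ φ hWT ?_
      ext
      refine t.from_truncGE_obj_ext ?_
      change _ ≫ t.descTruncGE γ.hom 0 ≫ β.hom = _ ≫ 0
      rw [← Category.assoc, t.π_descTruncGE, comp_zero]
      exact congrArg (·.hom) hγ
    ext
    rw [← t.π_descTruncGE γ.hom 0]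
    exact (congrArg ((t.truncGEπ 0).app G.obj ≫ ·.hom) hφ).trans comp_zero

end TorsionPair

end Tilting

theorem mainTheorem1_general {D : Type*} [Category* D] [Preadditive D] [HasZeroObject D]
    [HasShift D ℤ] [∀ n : ℤ, (shiftFunctor D n).Additive] [Pretriangulated D] [IsTriangulated D]
    (t : TStructure D) (τ : Tilting.TorsionPair t.heart.FullSubcategory) :
    (∀ (E₀ : t.heart.FullSubcategory) (hE₀ : τ.F E₀) (E : τ.tilt.FullSubcategory)
      (α : (⟨E₀.obj, τ.tilt_of_F hE₀⟩ : τ.tilt.FullSubcategory) ⟶ E),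
      Epi α ↔ ∃ hE : t.heart E.obj, τ.F ⟨E.obj, hE⟩ ∧
        τ.T (cokernel (ObjectProperty.homMk α.hom : E₀ ⟶ ⟨E.obj, hE⟩))) ∧
    (∀ (E₀ : t.heart.FullSubcategory) (hE₀ : τ.T E₀) (E : τ.tiltShift.FullSubcategory)
      (β : E ⟶ (⟨E₀.obj, τ.tiltShift_of_T hE₀⟩ : τ.tiltShift.FullSubcategory)),
      Mono β ↔ ∃ hE : t.heart E.obj, τ.T ⟨E.obj, hE⟩ ∧
        τ.F (kernel
          (ObjectProperty.homMk β.hom : (⟨E.obj, hE⟩ : t.heart.FullSubcategory) ⟶ E₀))) :=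
  ⟨τ.epi_tilt_iff, τ.mono_tiltShift_iff⟩

theorem mainTheorem1 {D : Type*} [Category* D] [Preadditive D] [HasZeroObject D] [HasShift D ℤ]
    [∀ n : ℤ, (shiftFunctor D n).Additive] [Pretriangulated D] [IsTriangulated D]
    (t : TStructure D) (ht : ∀ X : D, t.bounded X)
    (τ : Tilting.TorsionPair t.heart.FullSubcategory) :
    (∀ (E₀ : t.heart.FullSubcategory) (hE₀ : τ.F E₀) (E : τ.tilt.FullSubcategory)
      (α : (⟨E₀.obj, τ.tilt_of_F hE₀⟩ : τ.tilt.FullSubcategory) ⟶ E),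
      Epi α ↔ ∃ hE : t.heart E.obj, τ.F ⟨E.obj, hE⟩ ∧
        τ.T (cokernel (ObjectProperty.homMk α.hom : E₀ ⟶ ⟨E.obj, hE⟩))) ∧
    (∀ (E₀ : t.heart.FullSubcategory) (hE₀ : τ.T E₀) (E : τ.tiltShift.FullSubcategory)
      (β : E ⟶ (⟨E₀.obj, τ.tiltShift_of_T hE₀⟩ : τ.tiltShift.FullSubcategory)),
      Mono β ↔ ∃ hE : t.heart E.obj, τ.T ⟨E.obj, hE⟩ ∧
        τ.F (kernel
          (ObjectProperty.homMk β.hom : (⟨E.obj, hE⟩ : t.heart.FullSubcategory) ⟶ E₀))) :=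
  mainTheorem1_general t τ
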